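/- All graphs are finite and simple. A graph is locally irregular if any two adjacent vertices have distinct degrees. A locally irregular edge-coloring of a graph $G$ is a (not necessarily proper) edge-coloring such that, for every color, the subgraph formed by the edges of that color is locally irregular. A graph is decomposable if it admits a locally irregular edge-coloring, and the smallest number of colors in such a coloring is its locally irregular chromatic index $\chi'_{\mathrm{irr}}(G)$. Theorem. Let $G$ be a decomposable bipartite graph. Then $$\chi'_{\mathrm{irr}}(G) \le 7.$$ Moreover, if every connected component of $G$ has an even number of edges (for connected $G$: if $G$ has an even number of edges), then $$\chi'_{\mathrm{irr}}(G) \le 6.$$ -/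

import Mathlib

namespace SimpleGraph

/-- A (finite) graph is locally irregular if every vertex `u` has a degree distinct from the
degrees of all of its neighbors. The degree of `v` is the number of elements of `G.neighborSet v`. -/
def IsLocallyIrregular {V : Type*} (G : SimpleGraph V) : Prop :=
  ∀ u v : V, G.Adj u v → (G.neighborSet u).ncard ≠ (G.neighborSet v).ncard

/-- A locally irregular edge-coloring: a (not necessarily proper) coloring of the edges such that
for each color `k` the graph formed by the edges of color `k` is locally irregular. (The isolated
vertices of the spanning subgraph `C.labelGraph k` have no influence on the condition.) -/
def EdgeLabeling.IsLocallyIrregular {V K : Type*} {G : SimpleGraph V}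
    (C : G.EdgeLabeling K) : Prop :=
  ∀ k : K, (C.labelGraph k).IsLocallyIrregular

/-- `G` has a locally irregular edge-coloring with colors from a set of `n` colors. -/
def LocallyIrregularColorable {V : Type*} (G : SimpleGraph V) (n : ℕ) : Prop :=
  ∃ C : G.EdgeLabeling (Fin n), C.IsLocallyIrregular

/-- A (finite) graph is decomposable if it admits some locally irregular edge-coloring. -/
def IsDecomposable {V : Type*} (G : SimpleGraph V) : Prop :=
  ∃ n : ℕ, G.LocallyIrregularColorable n

/-- The locally irregular chromatic index: the smallest number of colors in a locally irregular
edge-coloring of `G`; it is `⊤` when `G` is not decomposable. -/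
noncomputable def locallyIrregularChromaticIndex {V : Type*} (G : SimpleGraph V) : ℕ∞ :=
  ⨅ n ∈ {n : ℕ | G.LocallyIrregularColorable n}, (n : ℕ∞)

end SimpleGraph

/-! The argument is about parity. A bipartite graph is locally irregular when all degrees on one
side `A` are even and all nonzero degrees on the other side are odd. Each component is brought close
to this shape by removing a few pieces that are cheap to color.

A forest with even degrees on one side needs only two colors
(`IsAcyclic.locallyIrregularColorable_two`), and every graph contains forests with prescribed degree
parities at all vertices of a component but one (`exists_acyclic_le_ndeg_parity`). Removing one such
forest makes the degrees in `A` even, except perhaps at a root `r`; if the number of edges is even,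
counting edges shows that `r` is even as well.

A graph with even degrees in `A` takes four colors (`CrossesSet.locallyIrregularColorable_four`). A
second forest, with two colors, makes the nonzero degrees outside `A` odd, except perhaps at one
vertex `w`. This forest only uses edges at a set `S ⊆ A` that connects the other side but contains
at most one neighbor of `w` (`CrossesSet.exists_connecting_set`). The other edges at `w` are thus
free for one locally irregular piece that repairs `w`, and the remainder is the fourth color.
Together this gives 4 + 2 = 6.

If the number of edges of a component is odd, decomposability forces a vertex of degree at least 3.
With this vertex as `r`, one further locally irregular piece corrects the parity at `r`; it is the
seventh color. -/

namespace SimpleGraph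

variable {V : Type*}

/-- The degree of `v`, as the number of elements of the neighbor set. -/
noncomputable def ndeg (G : SimpleGraph V) (v : V) : ℕ := (G.neighborSet v).ncard

/-! ### Colorings as families of edge-disjoint subgraphs -/

/-- In this form colorings can be cut and combined with the lattice operations on graphs. -/
theorem locallyIrregularColorable_iff {G : SimpleGraph V} {n : ℕ} :
    G.LocallyIrregularColorable n ↔ ∃ F : Fin n → SimpleGraph V,
      (∀ i, (F i).IsLocallyIrregular) ∧ (∀ i, F i ≤ G) ∧
        ∀ u v, G.Adj u v → ∃! i, (F i).Adj u v := by
  constructor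
  · rintro ⟨C, hC⟩
    refine ⟨C.labelGraph, hC, fun _ => C.labelGraph_le, fun u v h => ?_⟩
    simp only [EdgeLabeling.labelGraph_adj]
    exact ⟨C ⟨s(u, v), h⟩, ⟨h, rfl⟩, fun j hj => hj.2.symm⟩
  · rintro ⟨F, hF, hle, huniq⟩
    choose c hc hc' using huniq
    have hsymm : ∀ (x y : V) (h : G.Adj x y), c y x h.symm = c x y h := fun x y h =>
      hc' x y h _ ((hc y x h.symm).symm)
    refine ⟨EdgeLabeling.mk c hsymm, fun k => ?_⟩
    have : (EdgeLabeling.mk c hsymm).labelGraph k = F k := by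
      ext u v
      rw [EdgeLabeling.labelGraph_adj]
      constructor
      · rintro ⟨h, hk⟩
        have : c u v h = k := hk
        exact this ▸ hc u v h
      · intro h
        exact ⟨hle k h, (hc' u v (hle k h) k h).symm⟩
    rw [this]
    exact hF k

theorem IsLocallyIrregular.colorable_one {G : SimpleGraph V} (h : G.IsLocallyIrregular) :
    G.LocallyIrregularColorable 1 :=
  locallyIrregularColorable_iff.2 ⟨fun _ => G, fun _ => h, fun _ => le_rfl,
    fun _ _ huv => ⟨0, huv, fun _ _ => Subsingleton.elim _ _⟩⟩

theorem LocallyIrregularColorable.sup {G₁ G₂ : SimpleGraph V} {n m : ℕ}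
    (h₁ : G₁.LocallyIrregularColorable n) (h₂ : G₂.LocallyIrregularColorable m)
    (hd : Disjoint G₁ G₂) : (G₁ ⊔ G₂).LocallyIrregularColorable (n + m) := by
  rw [locallyIrregularColorable_iff] at *
  obtain ⟨F₁, hF₁, hle₁, hu₁⟩ := h₁
  obtain ⟨F₂, hF₂, hle₂, hu₂⟩ := h₂
  rw [disjoint_left] at hd
  refine ⟨Fin.append F₁ F₂, fun i => ?_, fun i => ?_, fun u v huv => ?_⟩
  · refine Fin.addCases (fun i => ?_) (fun i => ?_) i
    · simpa using hF₁ i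
    · simpa using hF₂ i
  · refine Fin.addCases (fun i => ?_) (fun i => ?_) i
    · simpa using (hle₁ i).trans le_sup_left
    · simpa using (hle₂ i).trans le_sup_right
  · rcases huv with huv | huv
    · obtain ⟨i, hi, hi'⟩ := hu₁ u v huv
      refine ⟨Fin.castAdd m i, by simpa using hi, fun j => ?_⟩
      refine Fin.addCases (fun j hj => ?_) (fun j hj => ?_) j
      · rw [hi' j (by simpa using hj)]
      · exact absurd (hle₂ j (by simpa using hj)) (hd _ _ huv)
    · obtain ⟨i, hi, hi'⟩ := hu₂ u v huv
      refine ⟨Fin.natAdd n i, by simpa using hi, fun j => ?_⟩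
      refine Fin.addCases (fun j hj => ?_) (fun j hj => ?_) j
      · exact absurd huv (hd _ _ (hle₁ j (by simpa using hj)))
      · rw [hi' j (by simpa using hj)]

theorem isLocallyIrregular_bot : (⊥ : SimpleGraph V).IsLocallyIrregular := fun _ _ h => h.elim

theorem LocallyIrregularColorable.succ {G : SimpleGraph V} {n : ℕ}
    (h : G.LocallyIrregularColorable n) : G.LocallyIrregularColorable (n + 1) := by
  simpa using h.sup (isLocallyIrregular_bot (V := V)).colorable_one disjoint_bot_right

/-! ### Reduction to connected components -/

/-- The spanning subgraph formed by the edges in a connected component. -/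
def componentGraph (G : SimpleGraph V) (c : G.ConnectedComponent) : SimpleGraph V where
  Adj u v := G.Adj u v ∧ G.connectedComponentMk u = c
  symm := ⟨fun _ _ h =>
    ⟨h.1.symm, (ConnectedComponent.connectedComponentMk_eq_of_adj h.1.symm).trans h.2⟩⟩
  loopless := ⟨fun _ h => h.1.ne rfl⟩

theorem componentGraph_le (G : SimpleGraph V) (c : G.ConnectedComponent) :
    G.componentGraph c ≤ G := fun _ _ h => h.1

theorem ndeg_componentGraph (G : SimpleGraph V) (v : V) :
    (G.componentGraph (G.connectedComponentMk v)).ndeg v = G.ndeg v := by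
  have : (G.componentGraph (G.connectedComponentMk v)).neighborSet v = G.neighborSet v := by
    ext u
    simp [componentGraph]
  rw [ndeg, this, ndeg]

theorem ndeg_componentGraph_of_ne (G : SimpleGraph V) {c : G.ConnectedComponent} {v : V}
    (h : G.connectedComponentMk v ≠ c) : (G.componentGraph c).ndeg v = 0 := by
  have : (G.componentGraph c).neighborSet v = ∅ := by
    ext u
    simp [componentGraph, h]
  simp [ndeg, this]

theorem reachable_componentGraph {G : SimpleGraph V} {u v : V} (h : G.Reachable u v) :
    (G.componentGraph (G.connectedComponentMk u)).Reachable u v := by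
  obtain ⟨p⟩ := h
  induction p with
  | nil => exact Reachable.refl _
  | @cons a b c hab p ih =>
    have hc := ConnectedComponent.connectedComponentMk_eq_of_adj hab
    rw [← hc] at ih
    exact (Adj.reachable (show (G.componentGraph _).Adj a b from ⟨hab, rfl⟩)).trans ih

theorem componentGraph_reachable_of_adj {G : SimpleGraph V} {c : G.ConnectedComponent}
    {u v u' v' : V} (hu : (G.componentGraph c).Adj u u') (hv : (G.componentGraph c).Adj v v') :
    (G.componentGraph c).Reachable u v := by
  obtain ⟨-, rfl⟩ := hu
  exact reachable_componentGraph (ConnectedComponent.exact hv.2.symm)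

theorem locallyIrregularColorable_of_componentGraph {G : SimpleGraph V} {n : ℕ}
    (h : ∀ c, (G.componentGraph c).LocallyIrregularColorable n) :
    G.LocallyIrregularColorable n := by
  simp only [locallyIrregularColorable_iff] at *
  choose F hF hle hu using h
  have hcomp : ∀ {i c u v}, (F c i).Adj u v → G.connectedComponentMk u = c :=
    fun h => (hle _ _ h).2
  have key : ∀ {u v : V}, G.Adj u v → G.connectedComponentMk u = G.connectedComponentMk v :=
    fun h => ConnectedComponent.connectedComponentMk_eq_of_adj h
  -- The color classes of the components are glued by looking up the component of the first end;
  -- this is symmetric because an edge stays in one component.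
  let K : Fin n → SimpleGraph V := fun i =>
    { Adj := fun u v => (F (G.connectedComponentMk u) i).Adj u v
      symm := ⟨fun u v h => by
        have := key (hle _ _ h).1
        rw [← this]
        exact h.symm⟩
      loopless := ⟨fun _ h => h.ne rfl⟩ }
  refine ⟨K, fun i u v huv => ?_, fun _ _ _ huv => (hle _ _ huv).1, fun u v huv =>
    hu _ u v ⟨huv, rfl⟩⟩
  have hc := key (hle _ _ huv).1
  have := hF _ i u v huv
  have e : (K i).neighborSet v = (F (G.connectedComponentMk u) i).neighborSet v := by
    rw [hc]
    rfl
  rw [e]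
  exact this

theorem LocallyIrregularColorable.componentGraph {G : SimpleGraph V} {n : ℕ}
    (h : G.LocallyIrregularColorable n) (c : G.ConnectedComponent) :
    (G.componentGraph c).LocallyIrregularColorable n := by
  rw [locallyIrregularColorable_iff] at *
  obtain ⟨F, hF, hle, hu⟩ := h
  refine ⟨fun i => F i ⊓ G.componentGraph c, fun i u v huv => ?_, fun i => inf_le_right,
    fun u v huv => ?_⟩
  · have e : ∀ w, G.connectedComponentMk w = c →
        (F i ⊓ G.componentGraph c).neighborSet w = (F i).neighborSet w := fun w hw => by
      ext z
      simp only [mem_neighborSet, inf_adj, SimpleGraph.componentGraph]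
      exact ⟨fun h => h.1, fun h => ⟨h, hle i h, hw⟩⟩
    rw [e u huv.2.2, e v huv.2.symm.2]
    exact hF i u v huv.1
  · obtain ⟨i, hi, hi'⟩ := hu u v huv.1
    exact ⟨i, ⟨hi, huv⟩, fun j hj => hi' j hj.1⟩

theorem ncard_edgeSet_componentGraph (G : SimpleGraph V) (c : G.ConnectedComponent) :
    (G.componentGraph c).edgeSet.ncard = c.toSimpleGraph.edgeSet.ncard := by
  have : G.componentGraph c = c.toSimpleGraph.spanningCoe := by
    ext u v
    rw [ConnectedComponent.adj_spanningCoe_toSimpleGraph]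
    exact and_comm
  rw [this, edgeSet_map]
  exact Set.ncard_image_of_injective _ (Function.Embedding.injective _)

theorem ndeg_edge [DecidableEq V] {a b : V} (hne : a ≠ b) (v : V) :
    (edge a b).ndeg v = (if v = a then 1 else 0) + if v = b then 1 else 0 := by
  by_cases hva : v = a
  · subst hva
    have : (edge v b).neighborSet v = {b} := by
      ext z
      simp only [mem_neighborSet, edge_adj, Set.mem_singleton_iff]
      grind
    rw [ndeg, this]
    simp [hne]
  · by_cases hvb : v = b
    · subst hvb
      have : (edge a v).neighborSet v = {a} := by
        ext z
        simp only [mem_neighborSet, edge_adj, Set.mem_singleton_iff]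
        grind
      rw [ndeg, this]
      simp [hne.symm]
    · have : (edge a b).neighborSet v = ∅ := by
        ext z
        simp only [mem_neighborSet, edge_adj, Set.mem_empty_iff_false]
        grind
      rw [ndeg, this]
      simp [hva, hvb]

/-! ### Degree arithmetic -/

section Degrees

variable [Finite V]

theorem ndeg_pos {G : SimpleGraph V} {u v : V} (h : G.Adj u v) : 0 < G.ndeg u :=
  (Set.ncard_pos (Set.toFinite _)).2 ⟨v, h⟩

theorem ndeg_eq_zero {G : SimpleGraph V} {v : V} : G.ndeg v = 0 ↔ ∀ u, ¬ G.Adj v u := by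
  rw [ndeg, Set.ncard_eq_zero, Set.eq_empty_iff_forall_notMem]
  rfl

theorem ndeg_mono {G H : SimpleGraph V} (h : G ≤ H) (v : V) : G.ndeg v ≤ H.ndeg v :=
  Set.ncard_le_ncard fun _ hu => h hu

theorem ndeg_sup {G H : SimpleGraph V} (h : Disjoint G H) (v : V) :
    (G ⊔ H).ndeg v = G.ndeg v + H.ndeg v := by
  rw [ndeg, neighborSet_sup, Set.ncard_union_eq]
  · rfl
  · rw [Set.disjoint_left]
    exact fun u hu hu' => disjoint_left.1 h v u hu hu'

theorem ndeg_sdiff_add {G H : SimpleGraph V} (h : H ≤ G) (v : V) :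
    (G \ H).ndeg v + H.ndeg v = G.ndeg v := by
  rw [← ndeg_sup disjoint_sdiff_self_left, sdiff_sup_cancel h]

theorem ndeg_symmDiff (G H : SimpleGraph V) (v : V) :
    ((symmDiff G H).ndeg v : ZMod 2) = G.ndeg v + H.ndeg v := by
  have h1 := ndeg_sdiff_add (G := G ⊔ H) (H := G ⊓ H) (inf_le_left.trans le_sup_left) v
  have h2 := ndeg_sdiff_add (G := G ⊔ H) (H := H) le_sup_right v
  have h3 := ndeg_sdiff_add (G := G) (H := G ⊓ H) inf_le_left v
  rw [← symmDiff_eq_sup_sdiff_inf] at h1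
  rw [sup_sdiff_right_self] at h2
  rw [sdiff_inf_self_left] at h3
  have h4 : (symmDiff G H).ndeg v + (G ⊓ H).ndeg v + (G ⊓ H).ndeg v = G.ndeg v + H.ndeg v := by
    omega
  have h5 := congrArg (Nat.cast : ℕ → ZMod 2) h4
  push_cast at h5
  rwa [add_assoc, CharTwo.add_self_eq_zero, add_zero] at h5

theorem ndeg_le_one {G : SimpleGraph V} {v : V} (h : (G.neighborSet v).Subsingleton) :
    G.ndeg v ≤ 1 := (Set.ncard_le_one_iff (Set.toFinite _)).2 fun ha hb => h ha hb

/-- A star is locally irregular unless it is a single edge. -/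
theorem isLocallyIrregular_of_star {G : SimpleGraph V} (c : V)
    (h : ∀ u v, G.Adj u v → u = c ∨ v = c) (hc : G.ndeg c ≠ 1) : G.IsLocallyIrregular := by
  have key : ∀ v, G.Adj c v → G.ndeg v = 1 := fun v hv =>
    le_antisymm (ndeg_le_one fun a ha b hb => by
      rw [(h v a ha).resolve_left hv.ne', (h v b hb).resolve_left hv.ne']) (ndeg_pos hv.symm)
  intro u v huv
  rcases h u v huv with rfl | rfl
  · exact fun h => hc (h.trans (key v huv))
  · exact fun h => hc (h.symm.trans (key u huv.symm))

end Degrees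

/-! ### Bipartitions and edge counts -/

/-- All edges have exactly one end in `A`. -/
def CrossesSet (G : SimpleGraph V) (A : Set V) : Prop :=
  ∀ ⦃u v⦄, G.Adj u v → (u ∈ A ↔ v ∉ A)

theorem CrossesSet.mono {G H : SimpleGraph V} {A : Set V} (h : H.CrossesSet A) (hle : G ≤ H) :
    G.CrossesSet A := fun _ _ huv => h (hle huv)

theorem CrossesSet.compl {G : SimpleGraph V} {A : Set V} (h : G.CrossesSet A) :
    G.CrossesSet Aᶜ := fun u v huv => by
  have := h huv
  simp only [Set.mem_compl_iff]
  tauto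

theorem CrossesSet.isLocallyIrregular {G : SimpleGraph V} {A : Set V} (h : G.CrossesSet A)
    (hne : ∀ x ∈ A, ∀ y ∉ A, G.Adj x y → G.ndeg x ≠ G.ndeg y) : G.IsLocallyIrregular := by
  intro u v huv
  by_cases hu : u ∈ A
  · exact hne u hu v ((h huv).1 hu) huv
  · have hv : v ∈ A := by
      by_contra hv
      exact hu ((h huv).2 hv)
    exact (hne v hv u hu huv.symm).symm

theorem CrossesSet.isBipartiteWith {G : SimpleGraph V} {A : Set V} (h : G.CrossesSet A) :
    G.IsBipartiteWith A Aᶜ where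
  disjoint := disjoint_compl_right
  mem_of_adj u v huv := by
    have := h huv
    simp only [Set.mem_compl_iff]
    tauto

theorem CrossesSet.ncard_edgeSet [Fintype V] {G : SimpleGraph V} {A : Finset V}
    (h : G.CrossesSet A) : G.edgeSet.ncard = ∑ v ∈ A, G.ndeg v := by
  classical
  have hb : G.IsBipartiteWith A (Aᶜ : Finset V) := by simpa using h.isBipartiteWith
  have := isBipartiteWith_sum_degrees_eq_card_edges hb
  rw [Set.ncard_eq_toFinset_card', ← edgeFinset, ← this]
  refine Finset.sum_congr rfl fun v _ => ?_
  rw [ndeg, Set.ncard_eq_toFinset_card']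
  rfl

theorem CrossesSet.even_ncard_edgeSet [Finite V] {G : SimpleGraph V} {A : Set V}
    (h : G.CrossesSet A) (he : ∀ v ∈ A, Even (G.ndeg v)) : Even G.edgeSet.ncard := by
  classical
  have := Fintype.ofFinite V
  rw [CrossesSet.ncard_edgeSet (A := A.toFinset) (by simpa using h)]
  exact Finset.even_sum _ fun v hv => he v (by simpa using hv)

/-- Each edge is counted once, at its end in `A`, so modulo 2 only the degree of `r` matters. -/
theorem CrossesSet.even_ncard_edgeSet_iff [Finite V] {G : SimpleGraph V} {A : Set V}
    (h : G.CrossesSet A) {r : V} (hr : r ∈ A) (he : ∀ v ∈ A, v ≠ r → Even (G.ndeg v)) :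
    Even G.edgeSet.ncard ↔ Even (G.ndeg r) := by
  classical
  have := Fintype.ofFinite V
  rw [CrossesSet.ncard_edgeSet (A := A.toFinset) (by simpa using h),
    ← Finset.add_sum_erase _ _ (show r ∈ A.toFinset by simpa using hr), Nat.even_add]
  have : Even (∑ v ∈ A.toFinset.erase r, G.ndeg v) :=
    Finset.even_sum _ fun v hv => he v (by simp at hv; exact hv.2) (by simp at hv; exact hv.1)
  simp [this]

/-! ### Forests and their two-colorings -/

/-- On a forest every edge function with values in `ZMod 2` is a coboundary. -/
theorem IsAcyclic.exists_coboundary [Finite V] {J : SimpleGraph V} (hJ : J.IsAcyclic)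
    (σ : V → V → ZMod 2) (hσ : ∀ u v, σ u v = σ v u) :
    ∃ f : V → ZMod 2, ∀ u v, J.Adj u v → f u + f v = σ u v := by
  classical
  induction h : J.edgeSet.ncard generalizing J with
  | zero =>
    refine ⟨0, fun u v huv => ?_⟩
    rw [Set.ncard_eq_zero, Set.eq_empty_iff_forall_notMem] at h
    exact absurd huv (h s(u, v))
  | succ n ih =>
    obtain ⟨e, he⟩ : J.edgeSet.Nonempty := by
      rw [← Set.ncard_pos]
      omega
    induction e with | h a b =>
    have hab : J.Adj a b := he
    have hbr := (isAcyclic_iff_forall_adj_isBridge.1 hJ) hab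
    rw [isBridge_iff] at hbr
    set J' := J.deleteEdges {s(a, b)} with hJ'
    have hcard : J'.edgeSet.ncard = n := by
      rw [hJ', edgeSet_deleteEdges, Set.ncard_sdiff_singleton_of_mem he, h]
      rfl
    obtain ⟨f, hf⟩ := ih (hJ.anti (deleteEdges_le _)) hcard
    -- A constant is added on the side of `a` after the bridge is deleted. This corrects the value
    -- on the bridge and changes no other edge sum.
    refine ⟨fun z => f z + if J'.Reachable a z then σ a b + f a + f b else 0, fun u v huv => ?_⟩
    have h2 : ∀ z : ZMod 2, z + z = 0 := CharTwo.add_self_eq_zero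
    have hab' : (f a + if J'.Reachable a a then σ a b + f a + f b else 0) +
        (f b + if J'.Reachable a b then σ a b + f a + f b else 0) = σ a b := by
      rw [if_pos (Reachable.refl _), if_neg hbr]
      linear_combination h2 (f a) + h2 (f b)
    by_cases hs : s(u, v) = s(a, b)
    · rcases Sym2.eq_iff.1 hs with ⟨rfl, rfl⟩ | ⟨rfl, rfl⟩
      · exact hab'
      · exact (add_comm _ _).trans (hab'.trans (hσ _ _))
    · have huv' : J'.Adj u v := by
        rw [hJ', deleteEdges_adj]
        exact ⟨huv, hs⟩
      have hr : J'.Reachable a u ↔ J'.Reachable a v :=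
        ⟨fun h => h.trans huv'.reachable, fun h => h.trans huv'.symm.reachable⟩
      rw [← hf u v huv']
      by_cases hc : J'.Reachable a u
      · simp only [hc, hr.1 hc, if_true]
        linear_combination h2 (σ a b + f a + f b)
      · simp only [hc, mt hr.2 hc, if_false]
        ring

/-- A forest does not contain a cycle of length four. -/
theorem IsAcyclic.eq_of_four_cycle [Finite V] {J : SimpleGraph V} (hJ : J.IsAcyclic)
    {v x y z : V} (hvy : J.Adj v y) (hvz : J.Adj v z) (hxy : J.Adj x y) (hxz : J.Adj x z)
    (hyz : y ≠ z) : x = v := by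
  classical
  by_contra hxv
  -- A coboundary sums to 0 around the four-cycle, whereas the indicator of one of its edges sums to
  -- 1.
  obtain ⟨f, hf⟩ := hJ.exists_coboundary
    (fun a b => if s(a, b) = s(v, y) then 1 else 0) (fun a b => by rw [Sym2.eq_swap])
  have h1 := hf v y hvy
  have h2 := hf v z hvz
  have h3 := hf x y hxy
  have h4 := hf x z hxz
  have hvz' := hvz.ne
  have hvy' := hvy.ne
  rw [if_pos rfl] at h1
  rw [if_neg (by simp [hyz.symm, hvy'])] at h2
  rw [if_neg (by simp [hxv, hvy'.symm])] at h3
  rw [if_neg (by simp [hxv, hvz'.symm])] at h4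
  have h0 : (1 : ZMod 2) = 0 := by
    have hc : ∀ z : ZMod 2, z + z = 0 := CharTwo.add_self_eq_zero
    linear_combination -h1 - h2 - h3 - h4 + hc (f v) + hc (f x) + hc (f y) + hc (f z)
  exact one_ne_zero h0

/-- A forest in which all vertices in one side of a bipartition have even degree decomposes into
two locally irregular subgraphs. -/
theorem IsAcyclic.locallyIrregularColorable_two [Finite V] {J : SimpleGraph V}
    (hJ : J.IsAcyclic) {A : Set V}
    (hA : J.CrossesSet A) (he : ∀ x ∈ A, Even (J.ndeg x)) : J.LocallyIrregularColorable 2 := by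
  classical
  have hch : ∀ y : V, ∃ x, 0 < J.ndeg y → J.Adj y x := fun y => by
    by_cases h : 0 < J.ndeg y
    · obtain ⟨x, hx⟩ := (Set.ncard_pos (Set.toFinite _)).1 h
      exact ⟨x, fun _ => hx⟩
    · exact ⟨y, fun h' => absurd h' h⟩
  choose g hg using hch
  let τ : V → V → Prop := fun x y => x ∈ A ∧ Even (J.ndeg y) ∧ g y = x
  -- On `A`, `f` is the color; at `y ∉ A` it is the color wanted for the neighbors of `y`. The
  -- prescribed value is 1 only between a `y` of even degree `d` and its chosen neighbor `g y`, so
  -- that `d` splits into the odd numbers 1 and `d - 1`. An odd degree is not split.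
  obtain ⟨f, hf⟩ := hJ.exists_coboundary
    (fun u v => if (u ∈ A ∧ v ∉ A ∧ τ u v) ∨ (v ∈ A ∧ u ∉ A ∧ τ v u) then 1 else 0)
    (fun u v => by simp only [or_comm])
  have hf' : ∀ x ∈ A, ∀ y ∉ A, J.Adj x y →
      f x = f y + if Even (J.ndeg y) ∧ g y = x then 1 else 0 := by
    intro x hx y hy hxy
    have := hf x y hxy
    simp only [hx, hy, τ, true_and, not_false_eq_true, not_true_eq_false, false_and, and_false,
      or_false] at this
    rw [← this]
    linear_combination -(CharTwo.add_self_eq_zero (f y))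
  -- An edge takes the color of its end in `A`; hence a vertex of `A` has its whole, even degree in
  -- one color.
  let F : ZMod 2 → SimpleGraph V := fun i =>
    { Adj := fun u v => J.Adj u v ∧ (u ∈ A ∧ f u = i ∨ v ∈ A ∧ f v = i)
      symm := ⟨fun u v h => ⟨h.1.symm, h.2.symm⟩⟩
      loopless := ⟨fun _ h => h.1.ne rfl⟩ }
  have hLI : ∀ i : ZMod 2, (F i).IsLocallyIrregular := by
    intro i
    have hFA : (F i).CrossesSet A := fun u v h => hA h.1
    refine hFA.isLocallyIrregular fun x hx y hy hxy => ?_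
    have hfx : f x = i := by
      rcases hxy.2 with h | h
      · exact h.2
      · exact absurd h.1 hy
    have hxeven : Even ((F i).ndeg x) := by
      have : (F i).neighborSet x = J.neighborSet x := by
        ext z
        exact ⟨fun h => h.1, fun h => ⟨h, Or.inl ⟨hx, hfx⟩⟩⟩
      rw [ndeg, this]
      exact he x hx
    have hyodd : Odd ((F i).ndeg y) := by
      have hmem : ∀ z, (F i).Adj y z ↔ J.Adj y z ∧ f z = i := fun z => by
        constructor
        · rintro ⟨h, h' | h'⟩
          · exact absurd h'.1 hy
          · exact ⟨h, h'.2⟩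
        · rintro ⟨h, h'⟩
          exact ⟨h, Or.inr ⟨(hA h.symm).2 hy, h'⟩⟩
      have hxyJ := hxy.1
      have hpos : 0 < J.ndeg y := ndeg_pos hxyJ.symm
      by_cases hev : Even (J.ndeg y)
      · by_cases hgx : g y = x
        · have hs : (F i).neighborSet y = {x} := by
            ext z
            rw [mem_neighborSet, hmem, Set.mem_singleton_iff]
            constructor
            · rintro ⟨h, h'⟩
              by_contra hz
              have e1 := hf' z ((hA h.symm).2 hy) y hy h.symm
              have e2 := hf' x hx y hy hxyJ
              rw [if_pos ⟨hev, hgx⟩] at e2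
              rw [if_neg (fun h => hz (h.2.symm.trans hgx)), h', ← hfx, e2] at e1
              simp at e1
            · rintro rfl
              exact ⟨hxyJ.symm, hfx⟩
          rw [ndeg, hs, Set.ncard_singleton]
          exact odd_one
        · have hs : (F i).neighborSet y = J.neighborSet y \ {g y} := by
            ext z
            rw [mem_neighborSet, hmem, Set.mem_sdiff, Set.mem_singleton_iff, mem_neighborSet]
            refine and_congr_right fun h => ?_
            have e1 := hf' z ((hA h.symm).2 hy) y hy h.symm
            have e2 := hf' x hx y hy hxyJ
            rw [if_neg (fun h => hgx h.2), add_zero, hfx] at e2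
            rw [← e2] at e1
            constructor
            · rintro rfl hz
              rw [if_pos ⟨hev, hz.symm⟩] at e1
              simp at e1
            · intro hz
              rw [if_neg (fun h => hz h.2.symm)] at e1
              simpa using e1
          rw [ndeg, hs, Set.ncard_sdiff_singleton_of_mem (show g y ∈ J.neighborSet y from hg y hpos)]
          exact Nat.Even.sub_odd hpos hev odd_one
      · have hs : (F i).neighborSet y = J.neighborSet y := by
          ext z
          rw [mem_neighborSet, hmem, mem_neighborSet]
          refine ⟨fun h => h.1, fun h => ⟨h, ?_⟩⟩
          rw [hf' z ((hA h.symm).2 hy) y hy h.symm, if_neg (fun h => hev h.1), ← hfx,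
            hf' x hx y hy hxyJ, if_neg (fun h => hev h.1)]
        rw [ndeg, hs]
        exact Nat.not_even_iff_odd.1 hev
    intro h
    rw [h] at hxeven
    exact Nat.not_even_iff_odd.2 hyodd hxeven
  refine locallyIrregularColorable_iff.2 ⟨F, hLI, fun i u v h => h.1, fun u v huv => ?_⟩
  · by_cases hu : u ∈ A
    · have hv := (hA huv).1 hu
      refine ⟨f u, ⟨huv, Or.inl ⟨hu, rfl⟩⟩, ?_⟩
      rintro i ⟨-, h | h⟩
      · exact h.2.symm
      · exact absurd h.1 hv
    · have hv : v ∈ A := (hA huv.symm).2 hu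
      refine ⟨f v, ⟨huv, Or.inr ⟨hv, rfl⟩⟩, ?_⟩
      rintro i ⟨-, h | h⟩
      · exact absurd h.1 hu
      · exact h.2.symm

/-! ### Subgraphs with prescribed degree parities -/

/-- Take the edges that a walk traverses an odd number of times; symmetric differences build this
set edge by edge. -/
theorem Reachable.exists_le_ndeg [Finite V] [DecidableEq V] {G : SimpleGraph V} {a w : V}
    (h : G.Reachable a w) : ∃ P ≤ G, ∀ v, (P.ndeg v : ZMod 2) =
      (if v = a then 1 else 0) + if v = w then 1 else 0 := by
  obtain ⟨p⟩ := h
  induction p with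
  | nil =>
    refine ⟨⊥, bot_le, fun v => ?_⟩
    rw [CharTwo.add_self_eq_zero]
    simp [ndeg]
  | @cons a b c hab p ih =>
    obtain ⟨P, hP, hdeg⟩ := ih
    refine ⟨symmDiff P (edge a b), symmDiff_le_sup.trans (sup_le hP (by simp [hab])),
      fun v => ?_⟩
    have he : ((edge a b).ndeg v : ZMod 2) = (if v = a then 1 else 0) + if v = b then 1 else 0 := by
      rw [ndeg_edge hab.ne]
      push_cast
      rfl
    rw [ndeg_symmDiff, hdeg, he]
    linear_combination CharTwo.add_self_eq_zero (if v = b then 1 else 0 : ZMod 2)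

/-- A subgraph with prescribed degree parities at all vertices that can be reached from `w`,
except `w` itself. -/
theorem exists_le_ndeg_parity [Finite V] (G : SimpleGraph V) (w : V) (D : V → ZMod 2) :
    ∃ J ≤ G, ∀ v, G.Reachable v w → v ≠ w → (J.ndeg v : ZMod 2) = D v := by
  classical
  have := Fintype.ofFinite V
  suffices h : ∀ s : Finset V, ∃ J ≤ G, ∀ v, G.Reachable v w → v ≠ w →
      (J.ndeg v : ZMod 2) = if v ∈ s then D v else 0 by
    simpa using h Finset.univ
  intro s
  induction s using Finset.induction_on with
  | empty => exact ⟨⊥, bot_le, fun v _ _ => by simp [ndeg]⟩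
  | insert a s ha ih =>
    obtain ⟨J, hJ, hdeg⟩ := ih
    by_cases h : G.Reachable a w ∧ D a = 1
    · obtain ⟨P, hP, hPdeg⟩ := h.1.exists_le_ndeg
      -- Toggling `P` changes the parity only at `a` and at the unconstrained vertex `w`.
      refine ⟨symmDiff J P, symmDiff_le_sup.trans (sup_le hJ hP), fun v hv hvw => ?_⟩
      rw [ndeg_symmDiff, hdeg v hv hvw, hPdeg, if_neg hvw]
      by_cases hva : v = a
      · subst hva
        simp [ha, h.2]
      · simp [hva]
    · refine ⟨J, hJ, fun v hv hvw => ?_⟩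
      rw [hdeg v hv hvw]
      by_cases hva : v = a
      · subst hva
        have : D v = 0 := by
          have h01 : ∀ z : ZMod 2, z ≠ 1 → z = 0 := by decide
          exact h01 _ fun h' => h ⟨hv, h'⟩
        simp [ha, this]
      · simp [hva]

/-- A maximal forest has the same reachability relation as the graph, so the parities can already be
realized inside it. -/
theorem exists_acyclic_le_ndeg_parity [Finite V] (G : SimpleGraph V) (w : V) (D : V → ZMod 2) :
    ∃ J ≤ G, J.IsAcyclic ∧
      ∀ v, G.Reachable v w → v ≠ w → (J.ndeg v : ZMod 2) = D v := by
  obtain ⟨F, hF⟩ : ∃ F, Maximal (fun H : SimpleGraph V => H ≤ G ∧ H.IsAcyclic) F :=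
    (Set.toFinite _).exists_maximal ⟨⊥, bot_le, isAcyclic_bot⟩
  have hr := reachable_eq_of_maximal_isAcyclic F hF
  obtain ⟨J, hJ, hdeg⟩ := F.exists_le_ndeg_parity w D
  exact ⟨J, hJ.trans hF.prop.1, hF.prop.2.anti hJ, fun v hv => hdeg v (by rw [hr]; exact hv)⟩

/-! ### Four colors when all degrees on one side are even -/

/-- The spanning subgraph formed by the edges that have an end in `S`. -/
def touching (G : SimpleGraph V) (S : Set V) : SimpleGraph V where
  Adj u v := G.Adj u v ∧ (u ∈ S ∨ v ∈ S)
  symm := ⟨fun _ _ h => ⟨h.1.symm, h.2.symm⟩⟩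
  loopless := ⟨fun _ h => h.1.ne rfl⟩

theorem touching_le (G : SimpleGraph V) (S : Set V) : G.touching S ≤ G := fun _ _ h => h.1

theorem CrossesSet.disjoint_touching {G : SimpleGraph V} {A S T : Set V} (hA : G.CrossesSet A)
    (hS : S ⊆ A) (hT : T ⊆ A) (hST : Disjoint S T) :
    Disjoint (G.touching S) (G.touching T) := by
  rw [disjoint_left]
  rw [Set.disjoint_left] at hST
  rintro u v ⟨huv, h | h⟩ ⟨-, h' | h'⟩
  · exact hST h h'
  · exact (hA huv).1 (hS h) (hT h')
  · exact (hA huv).1 (hT h') (hS h)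
  · exact hST h h'

theorem ndeg_touching_of_mem {G : SimpleGraph V} {S : Set V} {v : V} (h : v ∈ S) :
    (G.touching S).ndeg v = G.ndeg v := by
  have : (G.touching S).neighborSet v = G.neighborSet v := by
    ext u
    exact ⟨fun h => h.1, fun hu => ⟨hu, Or.inl h⟩⟩
  rw [ndeg, this, ndeg]

theorem LocallyIrregularColorable.of_parts {H J b : SimpleGraph V} (hJ : J ≤ H) (hb : b ≤ H)
    (hd : Disjoint J b) {k l m : ℕ} (hJc : J.LocallyIrregularColorable k)
    (hbc : b.LocallyIrregularColorable l) (hR : (H \ (J ⊔ b)).LocallyIrregularColorable m) :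
    H.LocallyIrregularColorable (m + (k + l)) := by
  have := hR.sup (hJc.sup hbc hd) disjoint_sdiff_self_left
  rwa [sdiff_sup_cancel (sup_le hJ hb)] at this

section Finite

variable [Finite V]

theorem CrossesSet.ndeg_touching_of_notMem {G : SimpleGraph V} {A S : Set V}
    (hA : G.CrossesSet A) (hS : S ⊆ A) {x : V} (hx : x ∈ A) (hxS : x ∉ S) :
    (G.touching S).ndeg x = 0 := by
  rw [ndeg_eq_zero]
  rintro u ⟨hu, h | h⟩
  · exact hxS h
  · exact (hA hu).1 hx (hS h)

theorem CrossesSet.even_ndeg_touching {G : SimpleGraph V} {A S : Set V} (hA : G.CrossesSet A)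
    (hS : S ⊆ A) (he : ∀ x ∈ A, Even (G.ndeg x)) {x : V} (hx : x ∈ A) :
    Even ((G.touching S).ndeg x) := by
  by_cases h : x ∈ S
  · rw [ndeg_touching_of_mem h]
    exact he x hx
  · rw [hA.ndeg_touching_of_notMem hS hx h]
    exact Even.zero

theorem ndeg_touching_singleton {G : SimpleGraph V} [DecidableRel G.Adj] {x v : V} (h : v ≠ x) :
    (G.touching {x}).ndeg v = if G.Adj x v then 1 else 0 := by
  split_ifs with hadj
  · have : (G.touching {x}).neighborSet v = {x} := by
      ext u
      simp only [mem_neighborSet, touching, Set.mem_singleton_iff, h, false_or]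
      exact ⟨fun h => h.2, fun h => ⟨h ▸ hadj.symm, h⟩⟩
    rw [ndeg, this, Set.ncard_singleton]
  · rw [ndeg_eq_zero]
    rintro u ⟨hu, hv | rfl⟩
    · exact h hv
    · exact hadj hu.symm

theorem isLocallyIrregular_touching_singleton {G : SimpleGraph V} {x : V} (h : G.ndeg x ≠ 1) :
    (G.touching {x}).IsLocallyIrregular :=
  isLocallyIrregular_of_star x (fun _ _ h => h.2) (by
    rwa [ndeg_touching_of_mem (Set.mem_singleton x)])

/-- The basic criterion: every edge joins an even degree to an odd one. -/
theorem CrossesSet.isLocallyIrregular_of_parity {G : SimpleGraph V} {A : Set V}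
    (hA : G.CrossesSet A) (he : ∀ x ∈ A, Even (G.ndeg x))
    (ho : ∀ y ∉ A, G.ndeg y ≠ 0 → Odd (G.ndeg y)) : G.IsLocallyIrregular := by
  refine hA.isLocallyIrregular fun x hx y hy hxy h => ?_
  have h1 := he x hx
  rw [h] at h1
  exact Nat.not_even_iff_odd.2 (ho y hy (ndeg_pos hxy.symm).ne') h1

/-- In a connected bipartite graph, the side `Aᶜ` is connected through some set `S ⊆ A` such that
some vertex of `Aᶜ` has at most one neighbor in `S`. -/
theorem CrossesSet.exists_connecting_set {H : SimpleGraph V} {A : Set V} (hA : H.CrossesSet A)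
    (hconn : ∀ u u' v v', H.Adj u u' → H.Adj v v' → H.Reachable u v)
    (hne : ∃ u v, H.Adj u v) : ∃ S ⊆ A, ∃ w ∉ A,
      (∀ y ∉ A, ∀ x, H.Adj y x → (H.touching S).Reachable y w) ∧
      {x | H.Adj w x ∧ x ∈ S}.Subsingleton := by
  have hmem : ∀ {u v}, H.Adj u v → u ∉ A → v ∈ A := fun huv hu => (hA huv.symm).2 hu
  obtain ⟨y₀, hy₀, x₀, hyx₀⟩ : ∃ y ∉ A, ∃ x, H.Adj y x := by
    obtain ⟨u, v, huv⟩ := hne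
    by_cases hu : u ∈ A
    · exact ⟨v, (hA huv).1 hu, u, huv.symm⟩
    · exact ⟨u, hu, v, huv⟩
  let P : Set V → Prop := fun S => S ⊆ A ∧ ∀ y ∉ A, ∀ x, H.Adj y x → ∀ y' ∉ A, ∀ x', H.Adj y' x' →
    (H.touching S).Reachable y y'
  have hPA : P A := by
    refine ⟨subset_rfl, fun y _ x hyx y' _ x' hyx' => ?_⟩
    have : H.touching A = H := by
      ext u v
      refine ⟨fun h => h.1, fun h => ⟨h, ?_⟩⟩
      by_cases hu : u ∈ A
      · exact Or.inl hu
      · exact Or.inr (hmem h hu)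
    rw [this]
    exact hconn y x y' x' hyx hyx'
  obtain ⟨S, hS⟩ := (Set.toFinite {S | P S}).exists_minimal ⟨A, hPA⟩
  have hSP : P S := hS.prop
  by_contra hcon
  -- A vertex violating this could serve as `w`.
  have htwo : ∀ y ∉ A, ∀ x, H.Adj y x → ∀ z, ∃ x' ∈ S, H.Adj y x' ∧ x' ≠ z := by
    intro y hy x hyx z
    by_contra hz
    push Not at hz
    refine hcon ⟨S, hSP.1, y, hy, fun y' hy' x' hyx' => hSP.2 y' hy' x' hyx' y hy x hyx,
      fun a ha b hb => ?_⟩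
    rw [hz a ha.2 ha.1, hz b hb.2 hb.1]
  obtain ⟨r, hrS, hyr, -⟩ := htwo y₀ hy₀ x₀ hyx₀ y₀
  -- A vertex `x` of `S` farthest from `r` is dispensable, against minimality: a shortest walk to
  -- `r` from another vertex of `S` avoids `x`, and by `htwo` every non-isolated vertex outside `A`
  -- has a neighbor in `S` other than `x`.
  obtain ⟨x, ⟨hxS, hxr⟩, hmax⟩ := Set.exists_max_image
    {x | x ∈ S ∧ (H.touching S).Reachable x r} (fun x => (H.touching S).dist x r)
    (Set.toFinite _) ⟨r, hrS, Reachable.refl _⟩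
  have key : ∀ {v c} (p : (H.touching S).Walk v c), p.length ≤ (H.touching S).dist x c → v ≠ x →
      (H.touching (S \ {x})).Reachable v c := by
    intro v c p
    induction p with
    | nil => exact fun _ _ => Reachable.refl _
    | @cons a b c hab p ih =>
      intro hp ha
      rw [Walk.length_cons] at hp
      have hb : b ≠ x := by
        rintro rfl
        have := dist_le p
        omega
      have hab' : (H.touching (S \ {x})).Adj a b :=
        ⟨hab.1, hab.2.imp (fun h => ⟨h, ha⟩) (fun h => ⟨h, hb⟩)⟩
      exact hab'.reachable.trans (ih (by omega) hb)
  have hall : ∀ y ∉ A, ∀ z, H.Adj y z → (H.touching (S \ {x})).Reachable y r := by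
    intro y hy z hyz
    obtain ⟨x', hx'S, hyx', hne'⟩ := htwo y hy z hyz x
    have hx'r : (H.touching S).Reachable x' r :=
      (Adj.reachable (show (H.touching S).Adj x' y from ⟨hyx'.symm, Or.inl hx'S⟩)).trans
        ((hSP.2 y hy z hyz y₀ hy₀ x₀ hyx₀).trans (Adj.reachable ⟨hyr, Or.inr hrS⟩))
    obtain ⟨p, hp⟩ := hx'r.exists_walk_length_eq_dist
    have hle := hmax x' ⟨hx'S, hx'r⟩
    exact (Adj.reachable (show (H.touching (S \ {x})).Adj y x' from
      ⟨hyx', Or.inr ⟨hx'S, hne'⟩⟩)).trans (key p (by rw [hp]; exact hle) hne')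
  have hP' : P (S \ {x}) := ⟨Set.sdiff_subset.trans hSP.1, fun y hy z hyz y' hy' z' hyz' =>
    (hall y hy z hyz).trans (hall y' hy' z' hyz').symm⟩
  have := hS.le_of_le hP' Set.sdiff_subset hxS
  exact this.2 rfl

theorem ndeg_sdiff_sup_add {H J b : SimpleGraph V} (hJ : J ≤ H) (hb : b ≤ H) (hd : Disjoint J b)
    (v : V) : (H \ (J ⊔ b)).ndeg v + J.ndeg v + b.ndeg v = H.ndeg v := by
  rw [add_assoc, ← ndeg_sup hd, ndeg_sdiff_add (sup_le hJ hb)]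

/-- A forest within `H.touching S` such that removing it from `H \ b` makes all degrees in `Aᶜ`
odd, with one possible exception. -/
theorem CrossesSet.exists_join {H : SimpleGraph V} {A S : Set V} (hA : H.CrossesSet A)
    {w : V} (hw : w ∉ A)
    (hreach : ∀ y ∉ A, ∀ x, H.Adj y x → (H.touching S).Reachable y w)
    {b : SimpleGraph V} (hb : b ≤ H) (hd : Disjoint (H.touching S) b) :
    ∃ J ≤ H.touching S, J.IsAcyclic ∧ (∀ x ∈ A, Even (J.ndeg x)) ∧
      ∀ y ∉ A, y ≠ w → (H \ (J ⊔ b)).ndeg y ≠ 0 → Odd ((H \ (J ⊔ b)).ndeg y) := by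
  classical
  -- Outside `A`, `J` gets the parity opposite to that of `H \ b`, so that an odd degree is left
  -- over.
  obtain ⟨J, hJ, hac, hpar⟩ := (H.touching S).exists_acyclic_le_ndeg_parity w
    (fun v => if v ∈ A then 0 else ((H \ b).ndeg v + 1 : ZMod 2))
  refine ⟨J, hJ, hac, fun x hx => ?_, fun y hy hyw hy0 => ?_⟩
  · by_cases h0 : J.ndeg x = 0
    · rw [h0]
      exact Even.zero
    · rw [ndeg_eq_zero] at h0
      push Not at h0
      obtain ⟨y, hxy⟩ := h0
      have hxy' := hJ hxy
      have hr := hreach y ((hA hxy'.1).1 hx) x hxy'.1.symm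
      have := hpar x (hxy'.reachable.trans hr) (fun h => hw (h ▸ hx))
      rw [if_pos hx] at this
      exact (ZMod.natCast_eq_zero_iff_even).1 this
  · have hex : ∃ x, H.Adj y x := by
      rw [Ne, ndeg_eq_zero] at hy0
      push Not at hy0
      exact hy0.imp fun x hx => hx.1
    obtain ⟨x, hyx⟩ := hex
    have := hpar y (hreach y hy x hyx) hyw
    rw [if_neg hy] at this
    have h1 := ndeg_sdiff_sup_add (hJ.trans (touching_le _ _)) hb (hd.mono_left hJ) y
    have h2 := ndeg_sdiff_add hb y
    have h3 : (H \ b).ndeg y = (H \ (J ⊔ b)).ndeg y + J.ndeg y := by omega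
    rw [h3] at this
    push_cast at this
    rw [← ZMod.natCast_eq_one_iff_odd]
    have h01 : ∀ a c : ZMod 2, c = a + c + 1 → a = 1 := by decide
    exact h01 _ _ this

end Finite

/-- The color budget: two for the forest `J`, one for the repairing piece `b`, one for the
remainder. -/
theorem IsAcyclic.locallyIrregularColorable_four [Finite V] {H J b : SimpleGraph V} {A : Set V}
    (hA : H.CrossesSet A) (hJ : J ≤ H) (hac : J.IsAcyclic) (he : ∀ x ∈ A, Even (J.ndeg x))
    (hb : b ≤ H) (hd : Disjoint J b) (hbi : b.IsLocallyIrregular)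
    (hR : (H \ (J ⊔ b)).IsLocallyIrregular) : H.LocallyIrregularColorable 4 :=
  .of_parts hJ hb hd (hac.locallyIrregularColorable_two (hA.mono hJ) he) hbi.colorable_one
    hR.colorable_one

/-- The repairing piece is the star at `x₀`. If `w` is left with an even positive degree, the edge
between `w` and `x₀` is returned to the remainder. There `w` gets an odd degree of at least 3 and
`x₀` gets degree 1, while the star keeps at least three edges. -/
theorem CrossesSet.locallyIrregularColorable_four_of_adj [Finite V] {H : SimpleGraph V}
    {A S : Set V} (hA : H.CrossesSet A) (he : ∀ x ∈ A, Even (H.ndeg x)) (hS : S ⊆ A) {w : V}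
    (hw : w ∉ A) (hreach : ∀ y ∉ A, ∀ x, H.Adj y x → (H.touching S).Reachable y w)
    {x₀ : V} (hx₀ : H.Adj w x₀) (hx₀S : x₀ ∉ S) (hx₀d : 4 ≤ H.ndeg x₀) :
    H.LocallyIrregularColorable 4 := by
  classical
  have hx₀A : x₀ ∈ A := (hA hx₀.symm).2 hw
  have hsub : {x₀} ⊆ A := Set.singleton_subset_iff.2 hx₀A
  have hd : Disjoint (H.touching S) (H.touching {x₀}) :=
    hA.disjoint_touching hS hsub (Set.disjoint_singleton_right.2 hx₀S)
  obtain ⟨J, hJ, hac, hJe, hJo⟩ := hA.exists_join hw hreach (touching_le H {x₀}) hd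
  have hJH := hJ.trans (touching_le _ _)
  have hsplit := ndeg_sdiff_sup_add hJH (touching_le H {x₀}) (hd.mono_left hJ)
  set R₀ := H \ (J ⊔ H.touching {x₀}) with hR₀
  have hR₀A : R₀.CrossesSet A := hA.mono sdiff_le
  have hR₀e : ∀ x ∈ A, Even (R₀.ndeg x) := fun x hx => by
    have h1 := he x hx
    rw [← hsplit x] at h1
    have h2 := hA.even_ndeg_touching hsub he hx
    have h3 := hJe x hx
    grind
  by_cases hbad : Even (R₀.ndeg w) ∧ R₀.ndeg w ≠ 0
  · let e := edge w x₀
    have hne := hx₀.ne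
    have hele : e ≤ H.touching {x₀} := by
      rw [edge_le_iff]
      exact Or.inr ⟨hx₀, Or.inr rfl⟩
    have hR : H \ (J ⊔ (H.touching {x₀} \ e)) = R₀ ⊔ e := by
      have h1 : e ≤ H := hele.trans (touching_le _ _)
      have h2 : Disjoint J e := (hd.mono_left hJ).mono_right hele
      ext u v
      have h1' := @h1 u v
      have h2' := disjoint_left.1 h2 u v
      simp only [hR₀, sdiff_adj, sup_adj]
      tauto
    have hde : Disjoint R₀ e := disjoint_sdiff_self_left.mono_right (hele.trans le_sup_right)
    have hRdeg : ∀ v, (R₀ ⊔ e).ndeg v =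
        R₀.ndeg v + ((if v = w then 1 else 0) + if v = x₀ then 1 else 0) := fun v => by
      rw [ndeg_sup hde, ndeg_edge hne]
    have hRx₀ : R₀.ndeg x₀ = 0 := by
      have := hsplit x₀
      rw [ndeg_touching_of_mem (Set.mem_singleton x₀)] at this
      omega
    refine hac.locallyIrregularColorable_four (b := H.touching {x₀} \ e) hA hJH hJe
      (sdiff_le.trans (touching_le _ _)) ((hd.mono_left hJ).mono_right sdiff_le) ?_ ?_
    · refine isLocallyIrregular_of_star x₀ (fun u v h => h.1.2) ?_
      have h1 := ndeg_sdiff_add hele x₀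
      rw [ndeg_touching_of_mem (Set.mem_singleton x₀), ndeg_edge hne, if_neg hne.symm,
        if_pos rfl] at h1
      omega
    · rw [hR]
      have hRA : (R₀ ⊔ e).CrossesSet A :=
        hA.mono (sup_le sdiff_le (hele.trans (touching_le _ _)))
      refine hRA.isLocallyIrregular fun x hx y hy hxy => ?_
      have hyx₀ : y ≠ x₀ := fun h => hy (h ▸ hx₀A)
      have hxw : x ≠ w := fun h => hw (h ▸ hx)
      rw [hRdeg, hRdeg, if_neg hyx₀, if_neg hxw]
      by_cases hyw : y = w
      · rw [if_pos hyw, hyw]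
        have := hR₀e x hx
        by_cases hxx : x = x₀
        · rw [if_pos hxx, hxx, hRx₀]
          omega
        · rw [if_neg hxx]
          grind
      · have hadj : R₀.Adj x y := by
          rcases hxy with h | h
          · exact h
          · rw [edge_adj] at h
            grind
        have hxx : x ≠ x₀ := by
          rintro rfl
          exact absurd hRx₀ (ndeg_pos hadj).ne'
        rw [if_neg hxx, if_neg hyw]
        have h1 := hR₀e x hx
        have h2 := hJo y hy hyw (ndeg_pos hadj.symm).ne'
        grind
  · refine hac.locallyIrregularColorable_four hA hJH hJe (touching_le _ _) (hd.mono_left hJ)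
      (isLocallyIrregular_touching_singleton (by omega)) ?_
    refine hR₀A.isLocallyIrregular_of_parity hR₀e fun y hy h0 => ?_
    by_cases hyw : y = w
    · subst hyw
      rw [← Nat.not_even_iff_odd]
      exact fun h => hbad ⟨h, h0⟩
    · exact hJo y hy hyw h0

/-- The star at the only neighbor of `w` outside `S`, if there is one, is split off. Then `w` keeps
at most its one edge into `S`, so its remaining degree is 0 or 1, which is harmless. -/
theorem CrossesSet.locallyIrregularColorable_four_of_subsingleton [Finite V] {H : SimpleGraph V}
    {A S : Set V} (hA : H.CrossesSet A) (he : ∀ x ∈ A, Even (H.ndeg x)) (hS : S ⊆ A) {w : V}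
    (hw : w ∉ A) (hreach : ∀ y ∉ A, ∀ x, H.Adj y x → (H.touching S).Reachable y w)
    (hwS : {x | H.Adj w x ∧ x ∈ S}.Subsingleton)
    (hZ : {x | H.Adj w x ∧ x ∉ S}.Subsingleton) : H.LocallyIrregularColorable 4 := by
  obtain ⟨b, hb, hd, hbi, hbe, hbw⟩ : ∃ b ≤ H, Disjoint (H.touching S) b ∧
      b.IsLocallyIrregular ∧ (∀ x ∈ A, Even (b.ndeg x)) ∧
      ∀ x, H.Adj w x → x ∉ S → b.Adj w x := by
    by_cases h : ∃ x, H.Adj w x ∧ x ∉ S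
    · obtain ⟨x, hwx, hxS⟩ := h
      have hxA : x ∈ A := (hA hwx.symm).2 hw
      have hsub : {x} ⊆ A := Set.singleton_subset_iff.2 hxA
      refine ⟨H.touching {x}, touching_le _ _, hA.disjoint_touching hS hsub
        (Set.disjoint_singleton_right.2 hxS), isLocallyIrregular_touching_singleton fun h => ?_,
        fun z hz => hA.even_ndeg_touching hsub he hz, fun z hwz hzS => ⟨hwz, Or.inr ?_⟩⟩
      · have := he x hxA
        rw [h] at this
        exact absurd this (by decide)
      · exact hZ ⟨hwz, hzS⟩ ⟨hwx, hxS⟩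
    · refine ⟨⊥, bot_le, disjoint_bot_right, isLocallyIrregular_bot, fun x _ => ?_,
        fun x hwx hxS => absurd ⟨x, hwx, hxS⟩ h⟩
      simp [ndeg]
  obtain ⟨J, hJ, hac, hJe, hJo⟩ := hA.exists_join hw hreach hb hd
  have hJH := hJ.trans (touching_le _ _)
  have hsplit := ndeg_sdiff_sup_add hJH hb (hd.mono_left hJ)
  refine hac.locallyIrregularColorable_four hA hJH hJe hb (hd.mono_left hJ) hbi ?_
  have hRA : (H \ (J ⊔ b)).CrossesSet A := hA.mono sdiff_le
  refine hRA.isLocallyIrregular_of_parity (fun x hx => ?_) fun y hy h0 => ?_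
  · have h1 := he x hx
    rw [← hsplit x] at h1
    have h2 := hbe x hx
    have h3 := hJe x hx
    grind
  · by_cases hyw : y = w
    · subst hyw
      have : (H \ (J ⊔ b)).ndeg y ≤ 1 := ndeg_le_one (hwS.anti fun x hx => ⟨hx.1, by
        by_contra hxS
        exact hx.2 (Or.inr (hbw x hx.1 hxS))⟩)
      have h1 : (H \ (J ⊔ b)).ndeg y = 1 := by omega
      rw [h1]
      exact odd_one
    · exact hJo y hy hyw h0

/-- Suppose the remainder is even at `w`. If a two-edge path leads from `w` through a neighbor
outside `S` to a vertex `z` of remaining degree 1, splitting it off makes `w` odd and isolates `z`.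
Otherwise all edges from `w` to its neighbors outside `S` are split off as a star centered at `w`.
-/
theorem CrossesSet.locallyIrregularColorable_four_of_nontrivial [Finite V] {H : SimpleGraph V}
    {A S : Set V} (hA : H.CrossesSet A) (he : ∀ x ∈ A, Even (H.ndeg x)) (hS : S ⊆ A) {w : V}
    (hw : w ∉ A) (hreach : ∀ y ∉ A, ∀ x, H.Adj y x → (H.touching S).Reachable y w)
    (hwS : {x | H.Adj w x ∧ x ∈ S}.Subsingleton)
    (hZ : {x | H.Adj w x ∧ x ∉ S}.Nontrivial)
    (hdeg : ∀ x, H.Adj w x → x ∉ S → H.ndeg x = 2) : H.LocallyIrregularColorable 4 := by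
  classical
  obtain ⟨J, hJ, hac, hJe, hJo⟩ := hA.exists_join hw hreach bot_le disjoint_bot_right
  have hJH := hJ.trans (touching_le _ _)
  rw [sup_bot_eq] at hJo
  have hsplit := ndeg_sdiff_add hJH
  set R₀ := H \ J with hR₀
  have hR₀A : R₀.CrossesSet A := hA.mono sdiff_le
  have hR₀e : ∀ x ∈ A, Even (R₀.ndeg x) := fun x hx => by
    have h1 := he x hx
    rw [← hsplit x] at h1
    have h3 := hJe x hx
    grind
  have hJZ : ∀ x, H.Adj w x → x ∉ S → J.ndeg x = 0 := fun x hwx hxS =>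
    Nat.le_zero.1 ((ndeg_mono hJ x).trans
      (hA.ndeg_touching_of_notMem hS ((hA hwx.symm).2 hw) hxS).le)
  have hfin : ∀ b ≤ H, Disjoint J b → ∀ v, (H \ (J ⊔ b)).ndeg v + b.ndeg v = R₀.ndeg v :=
    fun b hb hd v => by
      have h1 := ndeg_sdiff_sup_add hJH hb hd v
      have h2 := hsplit v
      omega
  by_cases hbad : Even (R₀.ndeg w)
  swap
  · refine hac.locallyIrregularColorable_four (b := ⊥) hA hJH hJe bot_le disjoint_bot_right
      isLocallyIrregular_bot ?_
    rw [sup_bot_eq]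
    refine hR₀A.isLocallyIrregular_of_parity hR₀e fun y hy h0 => ?_
    by_cases hyw : y = w
    · subst hyw
      exact Nat.not_even_iff_odd.1 hbad
    · exact hJo y hy hyw h0
  by_cases hleaf : ∃ x, H.Adj w x ∧ x ∉ S ∧ ∃ z ≠ w, H.Adj x z ∧ R₀.ndeg z = 1
  · obtain ⟨x, hwx, hxS, z, hzw, hxz, hz⟩ := hleaf
    have hxA : x ∈ A := (hA hwx.symm).2 hw
    have hsub : {x} ⊆ A := Set.singleton_subset_iff.2 hxA
    have hd : Disjoint (H.touching S) (H.touching {x}) :=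
      hA.disjoint_touching hS hsub (Set.disjoint_singleton_right.2 hxS)
    have hx2 := hdeg x hwx hxS
    have hsp := hfin _ (touching_le H {x}) (hd.mono_left hJ)
    have hnx : ∀ y, H.Adj x y ↔ y = w ∨ y = z := fun y => by
      have h1 : ({w, z} : Set V) = H.neighborSet x := by
        refine Set.eq_of_subset_of_ncard_le ?_ ?_ (Set.toFinite _)
        · rintro v (rfl | rfl)
          · exact hwx.symm
          · exact hxz
        · rw [Set.ncard_pair hzw.symm]
          exact hx2.le
      rw [← mem_neighborSet, ← h1]
      rfl
    refine hac.locallyIrregularColorable_four hA hJH hJe (touching_le H {x}) (hd.mono_left hJ)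
      (isLocallyIrregular_touching_singleton (by omega)) ?_
    have hRA : (H \ (J ⊔ H.touching {x})).CrossesSet A := hA.mono sdiff_le
    refine hRA.isLocallyIrregular_of_parity (fun v hv => ?_) fun y hy h0 => ?_
    · have h1 := hR₀e v hv
      rw [← hsp v] at h1
      have h2 := hA.even_ndeg_touching hsub he hv
      grind
    · have h1 := hsp y
      have hyx : y ≠ x := fun h => hy (h ▸ hxA)
      rw [ndeg_touching_singleton hyx] at h1
      simp only [hnx] at h1
      by_cases hyw : y = w
      · subst hyw
        simp only [true_or, if_true] at h1
        rw [← h1] at hbad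
        grind
      · by_cases hyz : y = z
        · subst hyz
          simp only [or_true, if_true] at h1
          omega
        · simp only [hyw, hyz, or_self, if_false, add_zero] at h1
          rw [h1]
          exact hJo y hy hyw (h1 ▸ h0)
  · push Not at hleaf
    let Z : Set V := {x | H.Adj w x ∧ x ∉ S}
    have hZA : Z ⊆ A := fun x hx => (hA hx.1.symm).2 hw
    let b : SimpleGraph V :=
      { Adj := fun u v => u = w ∧ v ∈ Z ∨ v = w ∧ u ∈ Z
        symm := ⟨fun u v h => h.symm⟩
        loopless := ⟨fun u h => by
          rcases h with ⟨rfl, h⟩ | ⟨rfl, h⟩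
          · exact h.1.ne rfl
          · exact h.1.ne rfl⟩ }
    have hb : b ≤ H := by
      rintro u v (⟨rfl, h⟩ | ⟨rfl, h⟩)
      · exact h.1
      · exact h.1.symm
    have hbZ : b ≤ H.touching Z := fun u v h => ⟨hb h, by
      rcases h with h | h
      · exact Or.inr h.2
      · exact Or.inl h.2⟩
    have hd : Disjoint J b :=
      ((hA.disjoint_touching hS hZA (Set.disjoint_left.2 fun x hx hx' => hx'.2 hx)).mono_left
        hJ).mono_right hbZ
    have hsp := hfin b hb hd
    have hwZ : w ∉ Z := fun h => hw (hZA h)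
    have hbn : ∀ v, v ≠ w → v ∉ Z → b.ndeg v = 0 := fun v hv hvZ => by
      rw [ndeg_eq_zero]
      rintro u (h | h)
      · exact hv h.1
      · exact hvZ h.2
    refine hac.locallyIrregularColorable_four hA hJH hJe hb hd
      (isLocallyIrregular_of_star w (fun u v h => h.imp And.left And.left) ?_) ?_
    · have : b.neighborSet w = Z := by
        ext v
        constructor
        · rintro (h | h)
          · exact h.2
          · exact absurd h.2 hwZ
        · exact fun h => Or.inl ⟨rfl, h⟩
      rw [ndeg, this]
      exact ((Set.one_lt_ncard_iff_nontrivial).2 hZ).ne'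
    · have hRA : (H \ (J ⊔ b)).CrossesSet A := hA.mono sdiff_le
      refine hRA.isLocallyIrregular fun x hx y hy hxy => ?_
      have hyZ : y ∉ Z := fun h => hy (hZA h)
      have hxw : x ≠ w := fun h => hw (h ▸ hx)
      have h1 := hsp x
      have h2 := hsp y
      have hy0 := ndeg_pos hxy.symm
      -- A vertex of `Z` keeps only its second edge and so has degree 1; by `hleaf` the other end of
      -- that edge has a different degree. The other vertices of `A` keep even degrees, and parity
      -- suffices.
      by_cases hxZ : x ∈ Z
      · have hyw : y ≠ w := fun h => hxy.2 (Or.inr (Or.inr ⟨h, hxZ⟩))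
        have h3 : b.ndeg x = 1 := by
          have : b.neighborSet x = {w} := by
            ext v
            constructor
            · rintro (h | h)
              · exact absurd h.1 hxw
              · exact h.1
            · exact fun h => Or.inr ⟨h, hxZ⟩
          rw [ndeg, this, Set.ncard_singleton]
        have h4 := hdeg x hxZ.1 hxZ.2
        have h5 := hJZ x hxZ.1 hxZ.2
        have h6 := hsplit x
        have h7 := hleaf x hxZ.1 hxZ.2 y hyw hxy.1
        rw [hbn y hyw hyZ] at h2
        omega
      · have h3 := hR₀e x hx
        rw [← h1, hbn x hxw hxZ, add_zero] at h3
        have h4 : Odd ((H \ (J ⊔ b)).ndeg y) := by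
          by_cases hyw : y = w
          · subst hyw
            have : (H \ (J ⊔ b)).ndeg y ≤ 1 := ndeg_le_one (hwS.anti fun x hx => ⟨hx.1, by
              by_contra hxS
              exact hx.2 (Or.inr (Or.inl ⟨rfl, hx.1, hxS⟩))⟩)
            have h1 : (H \ (J ⊔ b)).ndeg y = 1 := by omega
            rw [h1]
            exact odd_one
          · rw [hbn y hyw hyZ, add_zero] at h2
            rw [h2] at hy0 ⊢
            exact hJo y hy hyw hy0.ne'
        intro h
        rw [h] at h3
        exact Nat.not_even_iff_odd.2 h4 h3

/-- In each component the cases depend on the neighbors of `w` outside `S`: at most one; one of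
degree at least 4; or several, all of degree 2 since their degrees are even and positive. -/
theorem CrossesSet.locallyIrregularColorable_four [Finite V] {H : SimpleGraph V} {A : Set V}
    (hA : H.CrossesSet A) (he : ∀ x ∈ A, Even (H.ndeg x)) : H.LocallyIrregularColorable 4 := by
  refine locallyIrregularColorable_of_componentGraph fun c => ?_
  have hA' := hA.mono (componentGraph_le H c)
  have he' : ∀ x ∈ A, Even ((H.componentGraph c).ndeg x) := fun x hx => by
    by_cases h : H.connectedComponentMk x = c
    · subst h
      rw [ndeg_componentGraph]
      exact he x hx
    · rw [ndeg_componentGraph_of_ne H h]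
      exact Even.zero
  have hconn := fun u u' v v' hu hv =>
    componentGraph_reachable_of_adj (G := H) (c := c) (u := u) (v := v) (u' := u') (v' := v') hu hv
  generalize H.componentGraph c = K at *
  by_cases hne : ∃ u v, K.Adj u v
  · obtain ⟨S, hS, w, hw, hreach, hwS⟩ := hA'.exists_connecting_set hconn hne
    by_cases hZ : {x | K.Adj w x ∧ x ∉ S}.Subsingleton
    · exact hA'.locallyIrregularColorable_four_of_subsingleton he' hS hw hreach hwS hZ
    by_cases h4 : ∃ x, K.Adj w x ∧ x ∉ S ∧ 4 ≤ K.ndeg x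
    · obtain ⟨x, hwx, hxS, hx⟩ := h4
      exact hA'.locallyIrregularColorable_four_of_adj he' hS hw hreach hwx hxS hx
    · refine hA'.locallyIrregularColorable_four_of_nontrivial he' hS hw hreach hwS
        (Set.not_subsingleton_iff.1 hZ) fun x hwx hxS => ?_
      have h1 := he' x ((hA' hwx.symm).2 hw)
      have h2 := ndeg_pos hwx.symm
      have h3 : K.ndeg x < 4 := not_le.1 fun h => h4 ⟨x, hwx, hxS, h⟩
      grind
  · have : K = ⊥ := by
      ext u v
      exact ⟨fun h => (hne ⟨u, v, h⟩).elim, fun h => h.elim⟩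
    rw [this]
    exact isLocallyIrregular_bot.colorable_one.succ.succ.succ

/-! ### Six and seven colors for a connected graph -/

/-- A forest whose removal makes the degrees in `A` even, with one possible exception. -/
theorem exists_forest [Finite V] {G : SimpleGraph V} {A : Set V}
    (hconn : ∀ u u' v v', G.Adj u u' → G.Adj v v' → G.Reachable u v) {r r' : V} (hr : r ∈ A)
    (hrr' : G.Adj r r') :
    ∃ J ≤ G, J.IsAcyclic ∧ (∀ y ∈ Aᶜ, Even (J.ndeg y)) ∧
      ∀ x ∈ A, x ≠ r → Even ((G \ J).ndeg x) := by
  classical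
  obtain ⟨J, hJ, hac, hpar⟩ := G.exists_acyclic_le_ndeg_parity r
    (fun v => if v ∈ A then (G.ndeg v : ZMod 2) else 0)
  refine ⟨J, hJ, hac, fun y hy => ?_, fun x hx hxr => ?_⟩
  · by_cases h0 : J.ndeg y = 0
    · rw [h0]
      exact Even.zero
    · rw [ndeg_eq_zero] at h0
      push Not at h0
      obtain ⟨x, hyx⟩ := h0
      have := hpar y (hconn y x r r' (hJ hyx) hrr') (fun h => hy (h ▸ hr))
      rw [if_neg hy] at this
      exact (ZMod.natCast_eq_zero_iff_even).1 this
  · have hsplit := ndeg_sdiff_add hJ x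
    by_cases h0 : G.ndeg x = 0
    · have : (G \ J).ndeg x = 0 := by omega
      rw [this]
      exact Even.zero
    · rw [ndeg_eq_zero] at h0
      push Not at h0
      obtain ⟨y, hxy⟩ := h0
      have := hpar x (hconn x y r r' hxy hrr') hxr
      rw [if_pos hx, ← hsplit] at this
      push_cast at this
      rw [← ZMod.natCast_eq_zero_iff_even]
      simpa using this

/-- Counting at the ends outside `A`, the forest has an even number of edges, hence so has its
complement in `G`. Counting the latter at the ends in `A` shows that the exceptional vertex is even
too. -/
theorem CrossesSet.locallyIrregularColorable_six [Finite V] {G : SimpleGraph V} {A : Set V}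
    (hA : G.CrossesSet A)
    (hconn : ∀ u u' v v', G.Adj u u' → G.Adj v v' → G.Reachable u v)
    (heven : Even G.edgeSet.ncard) : G.LocallyIrregularColorable 6 := by
  by_cases hne : ∃ r ∈ A, ∃ r', G.Adj r r'
  · obtain ⟨r, hr, r', hrr'⟩ := hne
    obtain ⟨J, hJ, hac, hJe, hHe⟩ := exists_forest hconn hr hrr'
    have hJA := hA.mono hJ
    have hHA : (G \ J).CrossesSet A := hA.mono sdiff_le
    have hJeven := hJA.compl.even_ncard_edgeSet hJe
    have hcard : (G \ J).edgeSet.ncard + J.edgeSet.ncard = G.edgeSet.ncard := by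
      rw [edgeSet_sdiff, Set.ncard_sdiff_add_ncard_of_subset (edgeSet_mono hJ)]
    have hHeven : Even (G \ J).edgeSet.ncard := by
      rw [← hcard] at heven
      grind
    have hre := (hHA.even_ncard_edgeSet_iff hr hHe).1 hHeven
    have h4 := hHA.locallyIrregularColorable_four (fun x hx => by
      by_cases h : x = r
      · rw [h]
        exact hre
      · exact hHe x hx h)
    have := h4.sup (hac.locallyIrregularColorable_two hJA.compl hJe) disjoint_sdiff_self_left
    rwa [sdiff_sup_cancel hJ] at this
  · have : G = ⊥ := by
      ext u v
      refine ⟨fun h => (hne ?_).elim, fun h => h.elim⟩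
      by_cases hu : u ∈ A
      · exact ⟨u, hu, v, h⟩
      · exact ⟨v, (hA h.symm).2 hu, u, h.symm⟩
    rw [this]
    exact isLocallyIrregular_bot.colorable_one.succ.succ.succ.succ.succ

/-- If `r` is odd in `G \ J`, a piece `b` is removed whose part in `G \ J` corrects `r` and whose
part in `J` preserves the even degrees outside `A`. As `r` has degree at least 3, either `G \ J` has
three edges at `r`, or it has one and `J` has at least two. -/
theorem CrossesSet.locallyIrregularColorable_seven [Finite V] {G : SimpleGraph V} {A : Set V}
    (hA : G.CrossesSet A)
    (hconn : ∀ u u' v v', G.Adj u u' → G.Adj v v' → G.Reachable u v) {r : V} (hr : r ∈ A)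
    (hdeg : 3 ≤ G.ndeg r) : G.LocallyIrregularColorable 7 := by
  classical
  obtain ⟨r', hrr'⟩ : ∃ r', G.Adj r r' :=
    (Set.ncard_pos (Set.toFinite _)).1 (show 0 < G.ndeg r by omega)
  obtain ⟨J, hJ, hac, hJe, hHe⟩ := exists_forest hconn hr hrr'
  have hJA := hA.mono hJ
  have hHA : (G \ J).CrossesSet A := hA.mono sdiff_le
  have hrdeg := ndeg_sdiff_add hJ r
  by_cases hre : Even ((G \ J).ndeg r)
  · have h4 := hHA.locallyIrregularColorable_four (fun x hx => by
      by_cases h : x = r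
      · rw [h]
        exact hre
      · exact hHe x hx h)
    have := h4.sup (hac.locallyIrregularColorable_two hJA.compl hJe) disjoint_sdiff_self_left
    rw [sdiff_sup_cancel hJ] at this
    exact this.succ
  suffices h : ∃ b ≤ G, b.IsLocallyIrregular ∧ (∀ x ∈ A, Even (((G \ J) \ b).ndeg x)) ∧
      ∀ y ∈ Aᶜ, Even ((J \ b).ndeg y) by
    obtain ⟨b, hb, hbi, hbH, hbJ⟩ := h
    have h4 := (hHA.mono sdiff_le).locallyIrregularColorable_four hbH
    have h2 := (hac.anti sdiff_le).locallyIrregularColorable_two (hJA.compl.mono sdiff_le) hbJ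
    have hd : Disjoint (J \ b) b := disjoint_sdiff_self_left
    have hG : (G \ J) \ b = G \ ((J \ b) ⊔ b) := by
      rw [sdiff_sup_self, sdiff_sdiff_left]
    rw [hG] at h4
    exact .of_parts (sdiff_le.trans hJ) hb hd h2 hbi.colorable_one h4
  have hodd := Nat.not_even_iff_odd.1 hre
  by_cases h3 : 3 ≤ (G \ J).ndeg r
  -- Three edges rather than one: a single edge is not locally irregular.
  · obtain ⟨T, hT, hTcard⟩ := Set.exists_subset_card_eq (s := (G \ J).neighborSet r) h3
    have hTA : ∀ x ∈ T, x ∉ A := fun x hx => (hA (hT hx).1).1 hr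
    let b : SimpleGraph V :=
      { Adj := fun u v => u = r ∧ v ∈ T ∨ v = r ∧ u ∈ T
        symm := ⟨fun u v h => h.symm⟩
        loopless := ⟨fun u h => by
          rcases h with ⟨rfl, h⟩ | ⟨rfl, h⟩
          · exact (hT h).1.ne rfl
          · exact (hT h).1.ne rfl⟩ }
    have hbH : b ≤ G \ J := by
      rintro u v (⟨rfl, h⟩ | ⟨rfl, h⟩)
      · exact hT h
      · exact (hT h).symm
    have hbr : b.ndeg r = 3 := by
      have : b.neighborSet r = T := by
        ext v
        constructor
        · rintro (h | h)
          · exact h.2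
          · exact absurd hr (hTA r h.2)
        · exact fun h => Or.inl ⟨rfl, h⟩
      rw [ndeg, this, hTcard]
    refine ⟨b, hbH.trans sdiff_le,
      isLocallyIrregular_of_star r (fun u v h => h.imp And.left And.left) (by omega),
      fun x hx => ?_, fun y hy => ?_⟩
    · have h1 := ndeg_sdiff_add hbH x
      by_cases hxr : x = r
      · subst hxr
        grind
      · have h2 : b.ndeg x = 0 := by
          rw [ndeg_eq_zero]
          rintro v (h | h)
          · exact hxr h.1
          · exact hTA x h.2 hx
        have := hHe x hx hxr
        rw [h2, add_zero] at h1
        rwa [h1]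
    · have : J \ b = J := sdiff_eq_self_iff_disjoint.2
        ((disjoint_sdiff_self_left (x := J) (y := G)).mono_left hbH)
      rw [this]
      exact hJe y hy
  · have h1 : (G \ J).ndeg r = 1 := by grind
    obtain ⟨y, hy⟩ := Set.ncard_eq_one.1 h1
    have hry : (G \ J).Adj r y := by
      rw [← mem_neighborSet, hy]
      rfl
    obtain ⟨y₁, hy₁, y₂, hy₂, hne⟩ := (Set.one_lt_ncard_iff_nontrivial (s := J.neighborSet r)).1
      (show 1 < J.ndeg r by omega)
    have hA₁ : y₁ ∉ A := (hJA hy₁).1 hr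
    have hA₂ : y₂ ∉ A := (hJA hy₂).1 hr
    have hyA : y ∉ A := (hHA hry).1 hr
    have hyy₁ : y ≠ y₁ := by
      rintro rfl
      exact hry.2 hy₁
    have hyy₂ : y ≠ y₂ := by
      rintro rfl
      exact hry.2 hy₂
    have hP : ({y₁, y₂} : Set V) ⊆ Aᶜ := by
      rintro z (rfl | rfl)
      · exact hA₁
      · exact hA₂
    -- All edges of `J` at `y₁` and `y₂` are taken, so these two have even degree in `s` and none in
    -- `J \ s`. Together with the edge `e`, `r` gets degree 3; `y` gets degree 1, and so do the
    -- other neighbors of `y₁` and `y₂`, as the forest has no four-cycle.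
    let s := J.touching {y₁, y₂}
    let e := edge r y
    have hsJ : s ≤ J := touching_le _ _
    have heH : e ≤ G \ J := by
      rw [edge_le_iff]
      exact Or.inr hry
    have hse : Disjoint s e :=
      (disjoint_sdiff_self_left (x := J) (y := G)).symm.mono hsJ heH
    have hJb : J \ (s ⊔ e) = J \ s := by
      have : J \ e = J := sdiff_eq_self_iff_disjoint.2
        ((disjoint_sdiff_self_left (x := J) (y := G)).mono_left heH)
      rw [sup_comm, ← sdiff_sdiff_left, this]
    have hHb : (G \ J) \ (s ⊔ e) = (G \ J) \ e := by
      have : (G \ J) \ s = G \ J := sdiff_eq_self_iff_disjoint.2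
        ((disjoint_sdiff_self_left (x := J) (y := G)).symm.mono_left hsJ)
      rw [← sdiff_sdiff_left, this]
    have hbG : s ⊔ e ≤ G := sup_le (hsJ.trans hJ) (heH.trans sdiff_le)
    have hry' := hry.ne
    have hbdeg : ∀ v, (s ⊔ e).ndeg v =
        s.ndeg v + ((if v = r then 1 else 0) + if v = y then 1 else 0) := fun v => by
      rw [ndeg_sup hse, ndeg_edge hry']
    have hsy : ∀ z ∈ ({y₁, y₂} : Set V), Even (s.ndeg z) := fun z hz => by
      rw [ndeg_touching_of_mem hz]
      exact hJe z (hP hz)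
    have hsr : s.ndeg r = 2 := by
      have : s.neighborSet r = {y₁, y₂} := by
        ext v
        constructor
        · rintro ⟨-, h | h⟩
          · exact absurd hr (hP h)
          · exact h
        · intro h
          refine ⟨?_, Or.inr h⟩
          rcases h with rfl | rfl
          · exact hy₁
          · exact hy₂
      rw [ndeg, this, Set.ncard_pair hne]
    refine ⟨s ⊔ e, hbG, ?_, fun x hx => ?_, fun z hz => ?_⟩
    · refine (hA.mono hbG).isLocallyIrregular fun x hx z hz hxz => ?_
      have hxy : x ≠ y := fun h => hyA (h ▸ hx)
      have hzr : z ≠ r := fun h => hz (h ▸ hr)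
      rw [hbdeg, hbdeg, if_neg hxy, if_neg hzr]
      rcases hxz with hxz | hxz
      · have hzP : z ∈ ({y₁, y₂} : Set V) := hxz.2.resolve_left fun h => hP h hx
        have hzy : z ≠ y := by
          rintro rfl
          rcases hzP with h | h
          · exact hyy₁ h
          · exact hyy₂ h
        have hze := hsy z hzP
        rw [if_neg hzy]
        by_cases hxr : x = r
        · rw [if_pos hxr, hxr, hsr]
          grind
        · have hx1 : s.ndeg x ≤ 1 := by
            refine ndeg_le_one fun a ha b hb => ?_
            have ha' := ha.2.resolve_left fun h => hP h hx
            have hb' := hb.2.resolve_left fun h => hP h hx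
            by_contra hab
            apply hxr
            rcases ha' with rfl | rfl <;> rcases hb' with rfl | rfl
            · exact absurd rfl hab
            · exact hac.eq_of_four_cycle hy₁ hy₂ ha.1 hb.1 hne
            · exact hac.eq_of_four_cycle hy₁ hy₂ hb.1 ha.1 hne
            · exact absurd rfl hab
          have hx2 := ndeg_pos hxz
          rw [if_neg hxr]
          grind
      · rw [edge_adj] at hxz
        obtain ⟨rfl, rfl⟩ : x = r ∧ z = y := by grind
        have hsz : s.ndeg z = 0 := by
          rw [ndeg_eq_zero]
          rintro v ⟨hv, h | h⟩
          · rcases h with h | h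
            · exact hyy₁ h
            · exact hyy₂ h
          · exact hP h ((hJA hv.symm).2 hz)
        rw [hsr, hsz, if_pos rfl, if_pos rfl]
        omega
    · rw [hHb]
      have h2 := ndeg_sdiff_add heH x
      have hxy : x ≠ y := fun h => hyA (h ▸ hx)
      rw [ndeg_edge hry', if_neg hxy] at h2
      by_cases hxr : x = r
      · rw [if_pos hxr, hxr, h1] at h2
        rw [hxr]
        grind
      · rw [if_neg hxr] at h2
        have := hHe x hx hxr
        grind
    · rw [hJb]
      have h2 := ndeg_sdiff_add hsJ z
      have h3 := hJe z hz
      have h4 := hJA.compl.even_ndeg_touching hP hJe hz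
      rw [← h2] at h3
      exact (Nat.even_add.1 h3).2 h4

/-! ### Maximum degree two, and the conclusion -/

/-- A locally irregular graph of maximum degree at most two has an even number of edges. -/
theorem IsLocallyIrregular.even_ncard_edgeSet [Finite V] {F : SimpleGraph V}
    (hF : F.IsLocallyIrregular) (h2 : ∀ v, F.ndeg v ≤ 2) : Even F.edgeSet.ncard := by
  -- Every edge joins degree 1 to degree 2; counting at the ends of degree 2 gives an even number.
  have hA : F.CrossesSet {v | F.ndeg v = 2} := fun u v huv => by
    have h1 := ndeg_pos huv
    have h1' := ndeg_pos huv.symm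
    have hu := h2 u
    have hv := h2 v
    have hne : F.ndeg u ≠ F.ndeg v := hF u v huv
    simp only [Set.mem_ofPred_eq]
    omega
  refine hA.even_ncard_edgeSet fun v hv => ?_
  rw [Set.mem_ofPred_eq] at hv
  rw [hv]
  exact even_two

/-- Here decomposability enters: a decomposable component with an odd number of edges must have a
vertex of degree at least 3. -/
theorem LocallyIrregularColorable.even_ncard_edgeSet [Finite V] {G : SimpleGraph V} {n : ℕ}
    (h : G.LocallyIrregularColorable n) (h2 : ∀ v, G.ndeg v ≤ 2) : Even G.edgeSet.ncard := by
  rw [locallyIrregularColorable_iff] at h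
  obtain ⟨F, hF, hle, hu⟩ := h
  have hG : G.edgeSet = ⋃ i, (F i).edgeSet := by
    ext e
    induction e with | h u v =>
    rw [Set.mem_iUnion]
    exact ⟨fun h => (hu u v h).exists, fun ⟨i, hi⟩ => hle i hi⟩
  rw [hG, Set.ncard_iUnion_of_finite (fun _ => Set.toFinite _), finsum_eq_sum_of_fintype]
  · exact Finset.even_sum _ fun i _ =>
      (hF i).even_ncard_edgeSet fun v => (ndeg_mono (hle i) v).trans (h2 v)
  · intro i j hij
    rw [Function.onFun, Set.disjoint_left]
    intro e
    induction e with | h u v =>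
    exact fun hi hj => hij ((hu u v (hle i hi)).unique hi hj)

theorem LocallyIrregularColorable.locallyIrregularChromaticIndex_le {G : SimpleGraph V} {n : ℕ}
    (h : G.LocallyIrregularColorable n) : G.locallyIrregularChromaticIndex ≤ n :=
  iInf₂_le n h

end SimpleGraph

theorem theorem2 {V : Type*} [Finite V] (G : SimpleGraph V)
    (hbip : G.IsBipartite) (hdec : G.IsDecomposable) :
    G.locallyIrregularChromaticIndex ≤ 7 ∧
      ((∀ c : G.ConnectedComponent, Even c.toSimpleGraph.edgeSet.ncard) →
        G.locallyIrregularChromaticIndex ≤ 6) := by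
  obtain ⟨A, hA⟩ : ∃ A : Set V, G.CrossesSet A := by
    obtain ⟨s, t, h⟩ := hbip.exists_isBipartiteWith
    refine ⟨s, fun u v huv => ?_⟩
    have hd := Set.disjoint_left.1 h.disjoint
    have := h.mem_of_adj huv
    have h1 := @hd u
    have h2 := @hd v
    tauto
  have hconn := fun (c : G.ConnectedComponent) u u' v v' hu hv =>
    SimpleGraph.componentGraph_reachable_of_adj (G := G) (c := c) (u := u) (v := v) (u' := u')
      (v' := v') hu hv
  have hAc := fun c => hA.mono (SimpleGraph.componentGraph_le G c)
  obtain ⟨n, hn⟩ := hdec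
  refine ⟨(SimpleGraph.locallyIrregularColorable_of_componentGraph fun c =>
    ?_ : G.LocallyIrregularColorable 7).locallyIrregularChromaticIndex_le, fun heven =>
    (SimpleGraph.locallyIrregularColorable_of_componentGraph fun c =>
      ?_ : G.LocallyIrregularColorable 6).locallyIrregularChromaticIndex_le⟩
  · by_cases h : Even (G.componentGraph c).edgeSet.ncard
    · exact ((hAc c).locallyIrregularColorable_six (hconn c) h).succ
    · obtain ⟨r, hr⟩ : ∃ r, 3 ≤ (G.componentGraph c).ndeg r := by
        by_contra hcon
        push Not at hcon
        exact h ((hn.componentGraph c).even_ncard_edgeSet fun v => Nat.lt_succ_iff.1 (hcon v))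
      -- The two sides are interchangeable, so the side containing `r` takes the role of `A`.
      by_cases hrA : r ∈ A
      · exact (hAc c).locallyIrregularColorable_seven (hconn c) hrA hr
      · exact (hAc c).compl.locallyIrregularColorable_seven (hconn c) hrA hr
  · refine (hAc c).locallyIrregularColorable_six (hconn c) ?_
    rw [SimpleGraph.ncard_edgeSet_componentGraph]
    exact heven c
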